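/- Let $d\ge 1$ and let $A\subset\mathbb{R}^d$ be an affine subspace of dimension $a\ge 1$. Let $\mathfrak{A}\subset\mathbb{R}^{d+1}$ be the linear span of the points $(1,x_1,\dots,x_d)$ with $(x_1,\dots,x_d)\in A$, and let $\Gamma(A)=\mathfrak{A}\cap\mathbb{Z}^{d+1}$. Suppose that $\dim\Gamma(A)<a$, where $\dim\Gamma(A)$ is the dimension of the real linear span of $\Gamma(A)$. Put $$\Omega^*=\Bigl\{\xi=(\xi_1,\dots,\xi_d)\in A:\ q^{1/a}\cdot\max_{1\le i\le d}\|q\xi_i\|\to\infty\ \text{ as } q\to\infty,\ q\in\mathbb{Z}\Bigr\},$$ where $\|x\|$ is the distance from $x$ to the nearest integer. Fix any norm on $\mathbb{R}^d$ (for example the maximum norm or the Euclidean norm) and consider closed balls of positive radius in $A$ with respect to it. In Schmidt's $(\alpha,\beta)$-game on $A$, Black chooses a ball $B_0\subset A$ of any radius; then, for $n=0,1,2,\dots$, White chooses a ball $W_n\subset B_n$ whose radius is $\alpha$ times that of $B_n$, and Black chooses a ball $B_{n+1}\subset W_n$ whose radius is $\beta$ times that of $W_n$. A set $S\subset A$ is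 $(\alpha,\beta)$-winning in $A$ if White has a strategy which guarantees that the point of $\bigcap_n B_n$ belongs to $S$; it is $\alpha$-winning in $A$ if it is $(\alpha,\beta)$-winning for every $\beta\in(0,1)$. Then for all real $\alpha,\beta$ with $0<\alpha<1$, $0<\beta<1$ and $1+\alpha\beta-2\alpha>0$, the set $\Omega^*$ is $(\alpha,\beta)$-winning in $A$. In particular, $\Omega^*$ is $\alpha$-winning in $A$ for every $\alpha\in(0,1/2]$. -/

import Mathlib

namespace SchmidtGame

/-- `S` is an `(α, β)`-winning subset of `X` for Schmidt's game, where `B x r` is the closed ball of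
`X` with centre `x` and radius `r`. Black opens with any ball `B (b 0) ρ`, `ρ > 0`; White answers
a Black ball of radius `r` by a ball of radius `α * r` inside it, and Black answers a White ball of
radius `r'` by a ball of radius `β * r'` inside it. So the `n`-th Black ball has radius
`(α * β) ^ n * ρ`, and a move amounts to a centre. A strategy `σ` of White tells the centre of
White's `n`-th ball from `ρ` and the centres `b 0, …, b n` played so far by Black.
The set `S` is winning if White has a strategy that always prescribes a legal move as long as Black
has moved legally, and for which the balls of every infinite play shrink to a point of `S`. -/
def IsWinning {X : Type*} (B : X → ℝ → Set X) (α β : ℝ) (S : Set X) : Prop :=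
  ∃ σ : ℝ → (n : ℕ) → (Fin (n + 1) → X) → X, ∀ ρ : ℝ, 0 < ρ → ∀ b : ℕ → X,
    let r : ℕ → ℝ := fun n => (α * β) ^ n * ρ
    let w : ℕ → X := fun n => σ ρ n (fun i => b i)
    let legalBlack : ℕ → Prop := fun n => B (b (n + 1)) (r (n + 1)) ⊆ B (w n) (α * r n)
    let legalWhite : ℕ → Prop := fun n => B (w n) (α * r n) ⊆ B (b n) (r n)
    (∀ n, (∀ k < n, legalBlack k) → legalWhite n) ∧
      ((∀ n, legalBlack n) → ∃ ξ ∈ S, ⋂ n, B (b n) (r n) = {ξ})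

/-- `S` is `α`-winning if it is `(α, β)`-winning for every `β ∈ (0, 1)`. -/
def IsAlphaWinning {X : Type*} (B : X → ℝ → Set X) (α : ℝ) (S : Set X) : Prop :=
  ∀ β : ℝ, 0 < β → β < 1 → IsWinning B α β S

end SchmidtGame

namespace AffineApprox

/-- The closed ball in the affine subspace `A`, with respect to the norm `N` on `ℝ^d`. -/
def ball {d : ℕ} (A : AffineSubspace ℝ (Fin d → ℝ)) (N : Seminorm ℝ (Fin d → ℝ))
    (ξ : A) (ρ : ℝ) : Set A :=
  {η : A | N ((η : Fin d → ℝ) - (ξ : Fin d → ℝ)) ≤ ρ}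

/-- The linear span in `ℝ^(d+1)` of the points `(1, x)`, `x ∈ A`. -/
def cone {d : ℕ} (A : AffineSubspace ℝ (Fin d → ℝ)) : Submodule ℝ (Fin (d + 1) → ℝ) :=
  Submodule.span ℝ {v | ∃ x ∈ A, v = Fin.cons 1 x}

/-- The lattice `Γ(A)` of the integer points of `cone A`. -/
def lattice {d : ℕ} (A : AffineSubspace ℝ (Fin d → ℝ)) : Set (Fin (d + 1) → ℝ) :=
  {v | v ∈ cone A ∧ ∃ m : Fin (d + 1) → ℤ, ∀ i, v i = (m i : ℝ)}

/-- The dimension of `Γ(A)`, that is, of its real linear span. -/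
noncomputable def latticeDim {d : ℕ} (A : AffineSubspace ℝ (Fin d → ℝ)) : ℕ :=
  Module.finrank ℝ (Submodule.span ℝ (lattice A))

/-- The distance of a real number to the nearest integer. -/
noncomputable def distInt (x : ℝ) : ℝ := |x - round x|

/-- The points `ξ` of `A` with `q ^ (1 / a) * max_i ‖q ξ_i‖ → ∞` as the integer `q` tends to
infinity. -/
def omegaStar {d : ℕ} (A : AffineSubspace ℝ (Fin d → ℝ)) (a : ℕ) : Set A :=
  {ξ : A | Filter.Tendsto
    (fun q : ℕ => (q : ℝ) ^ ((1 : ℝ) / (a : ℝ)) *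
      ⨆ i : Fin d, distInt ((q : ℝ) * (ξ : Fin d → ℝ) i))
    Filter.atTop Filter.atTop}

end AffineApprox

namespace AffineApprox

/-! ### Norms on `ℝ^d` and forms on the direction of `A` -/

section Norm

variable {d : ℕ} (N : Seminorm ℝ (Fin d → ℝ))

/-! If `1 + αβ - 2α > 0`, White can use a fixed number of moves to get away from any given
hyperplane of `A`, to a distance proportional to the radius at the start of that block
(`exists_isWinning_of_avoids_hyperplanes`). It remains to choose one hyperplane per block.

Let `r i` be the radius at the start of block `2i`. This block deals with the denominators `q` for
which `q ^ (1 + 1 / a)` lies between `X i` and `X (i + 1)`, where `X i` is of order `C i / r i` and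
`C i → ∞` slowly. Consider the integer vectors `(q, p)` with `q ^ (1 + 1 / a) ≤ X (i + 1)` and `p /
q` within `O(r i)` of the current centre. If they span at most `a` dimensions, the projections of
the points `p / q` to `A` lie in one hyperplane; avoiding it gives `max ‖q ξ_k‖ ≥ const * q * r i`,
hence `q ^ (1 / a) * max ‖q ξ_k‖ ≥ C i` on this range (`exists_isUnitForm_of_finrank_span_le`).

Otherwise `a + 1` of the vectors are independent. Their minors are bounded in terms of `C (i + 1)`
alone (`abs_minor_le`), so Cramer's rule gives integer relations between their coordinates with
bounded coefficients. One of these does not vanish on `A`, since otherwise the vectors would span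
the cone over `A` and `Γ(A)` would have dimension `a + 1` (`exists_integer_relation`). The relation
is `O(r i)` at `ξ`. But the odd blocks avoid the zero set of every integer relation once, which
bounds each relation at `ξ` below by a positive constant known in advance. If `C` grows slowly
enough, this excludes the second case for all large `i`. -/

theorem seminorm_le_mul_norm : ∃ C : ℝ, 0 < C ∧ ∀ x, N x ≤ C * ‖x‖ := by
  refine ⟨∑ i, N (Pi.single i 1) + 1, ?_, fun x => ?_⟩
  · have : 0 ≤ ∑ i, N (Pi.single i (1 : ℝ)) := Finset.sum_nonneg fun i _ => apply_nonneg N _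
    linarith
  · have hx : x = ∑ i, x i • (Pi.single i (1 : ℝ) : Fin d → ℝ) := by
      ext j
      simp [Finset.sum_apply, Pi.single_apply]
    calc N x = N (∑ i, x i • (Pi.single i (1 : ℝ) : Fin d → ℝ)) := by rw [← hx]
      _ ≤ ∑ i, N (x i • (Pi.single i (1 : ℝ) : Fin d → ℝ)) :=
          Finset.le_sum_of_subadditive N (map_zero N).le (map_add_le_add N) _ _
      _ = ∑ i, |x i| * N (Pi.single i (1 : ℝ)) := by
          simp [map_smul_eq_mul]
      _ ≤ ∑ i, ‖x‖ * N (Pi.single i (1 : ℝ)) := by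
          refine Finset.sum_le_sum fun i _ => ?_
          exact mul_le_mul_of_nonneg_right (norm_le_pi_norm x i) (apply_nonneg N _)
      _ ≤ (∑ i, N (Pi.single i 1) + 1) * ‖x‖ := by
          rw [← Finset.mul_sum]
          nlinarith [norm_nonneg x]

theorem continuous_seminorm : Continuous N := by
  obtain ⟨C, -, hC⟩ := seminorm_le_mul_norm N
  refine Seminorm.continuous_of_le (q := (Real.toNNReal C) • normSeminorm ℝ (Fin d → ℝ)) ?_ ?_
  · have : Continuous fun x : Fin d → ℝ => (Real.toNNReal C : ℝ) * ‖x‖ := by fun_prop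
    exact this
  · intro x
    refine (hC x).trans ?_
    change C * ‖x‖ ≤ (Real.toNNReal C : ℝ) * ‖x‖
    exact mul_le_mul_of_nonneg_right (Real.le_coe_toNNReal C) (norm_nonneg x)

variable {N}

theorem norm_le_mul_seminorm (hN : ∀ x, N x = 0 → x = 0) :
    ∃ C : ℝ, 0 < C ∧ ∀ x, ‖x‖ ≤ C * N x := by
  by_cases hs : (Metric.sphere (0 : Fin d → ℝ) 1).Nonempty
  · obtain ⟨x₀, hx₀, hmin⟩ := (isCompact_sphere (0 : Fin d → ℝ) 1).exists_isMinOn hs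
      (continuous_seminorm N).continuousOn
    have hpos : 0 < N x₀ := by
      refine lt_of_le_of_ne (apply_nonneg N _) fun h => ?_
      have := hN x₀ h.symm
      subst this
      simp at hx₀
    refine ⟨(N x₀)⁻¹, inv_pos.2 hpos, fun x => ?_⟩
    rcases eq_or_ne x 0 with rfl | hx
    · simp
    have hnx : 0 < ‖x‖ := norm_pos_iff.2 hx
    have hmem : ‖x‖⁻¹ • x ∈ Metric.sphere (0 : Fin d → ℝ) 1 := by
      simp [norm_smul, hnx.ne']
    have h := hmin hmem
    simp only [Set.mem_ofPred_eq, map_smul_eq_mul, norm_inv, norm_norm] at h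
    rw [inv_mul_eq_div, le_div_iff₀ hpos]
    rw [inv_mul_eq_div, le_div_iff₀ hnx] at h
    linarith
  -- The sphere is empty only if `d = 0`.
  · refine ⟨1, one_pos, fun x => ?_⟩
    have hx : x = 0 := by
      by_contra hx
      exact hs ⟨‖x‖⁻¹ • x, by simp [norm_smul, (norm_pos_iff.2 hx).ne']⟩
    simp [hx]

/-- A linear form that does not vanish on the subspace `D` is a positive multiple of a form which
has norm one on `D` and attains it. -/
theorem exists_normalized_form (hN : ∀ x, N x = 0 → x = 0) {D : Submodule ℝ (Fin d → ℝ)}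
    (f : (Fin d → ℝ) →ₗ[ℝ] ℝ) (hf : ∃ e ∈ D, f e ≠ 0) :
    ∃ m : ℝ, 0 < m ∧ (∀ e ∈ D, |f e| ≤ m * N e) ∧ ∃ u ∈ D, N u ≤ 1 ∧ f u = m := by
  obtain ⟨C, hC, hCN⟩ := norm_le_mul_seminorm hN
  have hNc := continuous_seminorm N
  have hK : IsCompact ({x | N x ≤ 1} ∩ (D : Set (Fin d → ℝ))) := by
    refine Metric.isCompact_of_isClosed_isBounded ?_ ?_
    · exact (isClosed_le hNc continuous_const).inter D.closed_of_finiteDimensional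
    · refine (Metric.isBounded_closedBall (x := (0 : Fin d → ℝ)) (r := C)).subset ?_
      rintro x ⟨hx, -⟩
      rw [mem_closedBall_zero_iff]
      have hx' : N x ≤ 1 := hx
      calc ‖x‖ ≤ C * N x := hCN x
        _ ≤ C := by nlinarith
  obtain ⟨u, ⟨hu1, huD⟩, hmax⟩ := hK.exists_isMaxOn ⟨0, by simp, D.zero_mem⟩
    f.continuous_of_finiteDimensional.continuousOn
  have key : ∀ e ∈ D, f e ≤ f u * N e := by
    intro e he
    rcases (apply_nonneg N e).eq_or_lt with h0 | hpos
    · have := hN e h0.symm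
      subst this
      simp
    · have hmem : (N e)⁻¹ • e ∈ {x | N x ≤ 1} ∩ (D : Set (Fin d → ℝ)) := by
        refine ⟨?_, D.smul_mem _ he⟩
        simp [map_smul_eq_mul, abs_of_pos hpos, hpos.ne']
      have h := hmax hmem
      simp only [Set.mem_ofPred_eq, map_smul, smul_eq_mul] at h
      rwa [inv_mul_eq_div, div_le_iff₀ hpos] at h
  have key' : ∀ e ∈ D, |f e| ≤ f u * N e := by
    intro e he
    refine abs_le.2 ⟨?_, key e he⟩
    have := key (-e) (D.neg_mem he)
    simp only [map_neg, map_neg_eq_map] at this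
    linarith
  refine ⟨f u, ?_, key', u, huD, hu1, rfl⟩
  obtain ⟨e, heD, he⟩ := hf
  have h1 := (abs_pos.2 he).trans_le (key' e heD)
  by_contra hneg
  have h2 := apply_nonneg N e
  nlinarith [not_lt.1 hneg]

end Norm

/-! ### White's strategy against a sequence of hyperplanes -/

section Game

variable {d : ℕ} {A : AffineSubspace ℝ (Fin d → ℝ)} {N : Seminorm ℝ (Fin d → ℝ)}

/-- The translate of a point of `A` by a vector of its direction. -/
def translate (x : A) (u : A.direction) : A :=
  ⟨(u : Fin d → ℝ) + x, AffineSubspace.vadd_mem_of_mem_direction u.2 x.2⟩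

theorem ball_subset_ball {x y : A} {r s : ℝ} (h : N ((x : Fin d → ℝ) - y) ≤ s - r) :
    ball A N x r ⊆ ball A N y s := by
  intro z hz
  have hz' : N ((z : Fin d → ℝ) - x) ≤ r := hz
  have h1 := map_add_le_add N ((z : Fin d → ℝ) - x) ((x : Fin d → ℝ) - y)
  rw [sub_add_sub_cancel] at h1
  change N ((z : Fin d → ℝ) - y) ≤ s
  linarith

/-- Nested balls of radii tending to zero meet in a point. -/
theorem exists_iInter_ball_eq_singleton (hN : ∀ x, N x = 0 → x = 0) {b : ℕ → A} {r : ℕ → ℝ}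
    (hr0 : ∀ n, 0 ≤ r n) (hr : Filter.Tendsto r Filter.atTop (nhds 0))
    (hb : ∀ n, ball A N (b (n + 1)) (r (n + 1)) ⊆ ball A N (b n) (r n)) :
    ∃ ξ : A, ⋂ n, ball A N (b n) (r n) = {ξ} := by
  obtain ⟨C, hC, hCN⟩ := norm_le_mul_seminorm hN
  have hNc := continuous_seminorm N
  have hcl : ∀ n, IsClosed ({y : Fin d → ℝ | N (y - b n) ≤ r n} ∩ (A : Set (Fin d → ℝ))) := by
    intro n
    refine IsClosed.inter ?_ A.closed_of_finiteDimensional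
    exact isClosed_le (hNc.comp (continuous_id.sub continuous_const)) continuous_const
  obtain ⟨y, hy⟩ := IsCompact.nonempty_iInter_of_sequence_nonempty_isCompact_isClosed
    (fun n => {y : Fin d → ℝ | N (y - b n) ≤ r n} ∩ (A : Set (Fin d → ℝ)))
    (fun n y hy => ⟨hb n (show (⟨y, hy.2⟩ : A) ∈ _ from hy.1), hy.2⟩)
    (fun n => ⟨b n, by simpa using hr0 n, (b n).2⟩)
    (by
      refine Metric.isCompact_of_isClosed_isBounded (hcl 0) ?_
      refine (Metric.isBounded_closedBall (x := (b 0 : Fin d → ℝ)) (r := C * r 0)).subset ?_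
      rintro x ⟨hx, -⟩
      rw [Metric.mem_closedBall, dist_eq_norm]
      exact (hCN _).trans (mul_le_mul_of_nonneg_left hx hC.le))
    hcl
  rw [Set.mem_iInter] at hy
  refine ⟨⟨y, (hy 0).2⟩, ?_⟩
  ext z
  simp only [Set.mem_iInter, Set.mem_singleton_iff]
  constructor
  · intro hz
    have hlim : Filter.Tendsto (fun n => r n + r n) Filter.atTop (nhds 0) := by
      simpa using hr.add hr
    have hle : N ((z : Fin d → ℝ) - y) ≤ 0 := by
      refine ge_of_tendsto' hlim fun n => ?_
      have h1 : N ((z : Fin d → ℝ) - b n) ≤ r n := hz n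
      have h2 : N (y - b n) ≤ r n := (hy n).1
      have h3 := map_sub_le_add N ((z : Fin d → ℝ) - b n) (y - b n)
      rw [sub_sub_sub_cancel_right] at h3
      linarith
    exact Subtype.ext (sub_eq_zero.1 (hN _ (le_antisymm hle (apply_nonneg N _))))
  · rintro rfl n
    exact (hy n).1

/-- White can stay away from one hyperplane per block of `t` moves: if `1 + αβ - 2α > 0`, then a set
is winning as soon as it contains the outcome of every play which, for each `j`, stays at distance
at least `κ (αβ)^(tj) ρ` from a hyperplane that depends only on `ρ`, the opening centre, `j` and the
centre of the Black ball at the beginning of the `j`-th block. -/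
theorem exists_isWinning_of_avoids_hyperplanes (hN : ∀ x, N x = 0 → x = 0) {α β : ℝ} (hα : 0 < α)
    (hα1 : α < 1) (hβ : 0 < β) (hβ1 : β < 1) (hαβ : 0 < 1 + α * β - 2 * α) :
    ∃ (t : ℕ) (κ : ℝ), 0 < t ∧ 0 < κ ∧ ∀ S : Set A,
      (∀ ρ : ℝ, 0 < ρ → ∀ x₀ : A, ∃ (f : ℕ → A → (Fin d → ℝ) →ₗ[ℝ] ℝ) (c : ℕ → A → ℝ)
        (u : ℕ → A → A.direction),
        (∀ j x, (∀ e ∈ A.direction, |f j x e| ≤ N e) ∧ N (u j x) ≤ 1 ∧ f j x (u j x) = 1) ∧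
        ∀ (ξ : A) (x : ℕ → A), x 0 = x₀ →
          (∀ j, N ((ξ : Fin d → ℝ) - x j) ≤ ((α * β) ^ t) ^ j * ρ) →
          (∀ j, κ * (((α * β) ^ t) ^ j * ρ) ≤ |f j (x j) ξ + c j (x j)|) → ξ ∈ S) →
      SchmidtGame.IsWinning (ball A N) α β S := by
  have hab : 0 < α * β := mul_pos hα hβ
  have hab1 : α * β < 1 := by nlinarith
  obtain ⟨t, ht⟩ := exists_pow_lt_of_lt_one (half_pos hαβ) hab1
  have ht' : (α * β) ^ (t + 1) < (1 + α * β - 2 * α) / 2 :=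
    lt_of_le_of_lt (pow_le_pow_of_le_one hab.le hab1.le (Nat.le_succ t)) ht
  clear ht
  obtain ⟨T, hT0, hT⟩ : ∃ T : ℕ, 0 < T ∧ (α * β) ^ T < (1 + α * β - 2 * α) / 2 :=
    ⟨t + 1, t.succ_pos, ht'⟩
  refine ⟨T, (1 + α * β - 2 * α) / 2, hT0, half_pos hαβ, fun S hS => ?_⟩
  choose! f c u hfu hmem using hS
  have hlast : ∀ n : ℕ, T * (n / T) < n + 1 := fun n => Nat.lt_succ_of_le (Nat.mul_div_le n T)
  -- The side of the hyperplane is chosen at the start of the block and kept throughout it.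
  let sgn : ℝ → A → ℕ → A → ℝ := fun ρ x₀ j x =>
    if 0 ≤ f ρ x₀ j x x + c ρ x₀ j x then 1 else -1
  have hsgn : ∀ ρ x₀ j x, |sgn ρ x₀ j x| = 1 := by
    intro ρ x₀ j x
    simp only [sgn]
    split_ifs <;> simp
  -- White goes as far from the hyperplane as the rules allow, by `1 - α` times the current radius.
  -- The index `T * (n / T)` is the start of the current block.
  let σ : ℝ → (n : ℕ) → (Fin (n + 1) → A) → A := fun ρ n h =>
    translate (h (Fin.last n)) ((sgn ρ (h 0) (n / T) (h ⟨T * (n / T), hlast n⟩) *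
      ((1 - α) * ((α * β) ^ n * ρ))) • u ρ (h 0) (n / T) (h ⟨T * (n / T), hlast n⟩))
  refine ⟨σ, fun ρ hρ b => ?_⟩
  intro r w legalBlack legalWhite
  have hrpos : ∀ n, 0 < r n := fun n => mul_pos (pow_pos hab n) hρ
  have hrs : ∀ n, r (n + 1) = α * β * r n := fun n => by simp only [r, pow_succ]; ring
  let s : ℕ → ℝ := fun j => sgn ρ (b 0) j (b (T * j))
  let U : ℕ → Fin d → ℝ := fun j => u ρ (b 0) j (b (T * j))
  let F : ℕ → (Fin d → ℝ) →ₗ[ℝ] ℝ := fun j => f ρ (b 0) j (b (T * j))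
  have hs : ∀ j, |s j| = 1 := fun j => hsgn _ _ _ _
  have hU : ∀ j, N (U j) ≤ 1 := fun j => (hfu ρ hρ (b 0) j (b (T * j))).2.1
  have hFU : ∀ j, F j (U j) = 1 := fun j => (hfu ρ hρ (b 0) j (b (T * j))).2.2
  have hF : ∀ j, ∀ e ∈ A.direction, |F j e| ≤ N e := fun j => (hfu ρ hρ (b 0) j (b (T * j))).1
  have hUmem : ∀ j, U j ∈ A.direction := fun j => (u ρ (b 0) j (b (T * j))).2
  have hss : ∀ j, s j * s j = 1 := fun j => by rw [← abs_mul_abs_self, hs, one_mul]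
  have hw : ∀ n, (w n : Fin d → ℝ) = (s (n / T) * ((1 - α) * r n)) • U (n / T) + b n :=
    fun n => rfl
  have hwhite : ∀ n, legalWhite n := by
    intro n
    refine ball_subset_ball ?_
    rw [hw, add_sub_cancel_right, map_smul_eq_mul, Real.norm_eq_abs, abs_mul, hs, one_mul,
      abs_of_pos (mul_pos (by linarith) (hrpos n))]
    have := mul_le_mul_of_nonneg_left (hU (n / T)) (mul_pos (sub_pos.2 hα1) (hrpos n)).le
    linarith
  refine ⟨fun n _ => hwhite n, fun hblack => ?_⟩
  obtain ⟨ξ, hξ⟩ := exists_iInter_ball_eq_singleton (A := A) (b := b) hN (fun n => (hrpos n).le)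
    (by simpa [r] using (tendsto_pow_atTop_nhds_zero_of_lt_one hab.le hab1).mul_const ρ)
    (fun n => (hblack n).trans (hwhite n))
  refine ⟨ξ, ?_, hξ⟩
  have hξn : ∀ n, N ((ξ : Fin d → ℝ) - b n) ≤ r n := by
    have : ξ ∈ ⋂ n, ball A N (b n) (r n) := by rw [hξ]; rfl
    exact fun n => Set.mem_iInter.1 this n
  have hrT : ∀ j, r (T * j) = ((α * β) ^ T) ^ j * ρ := fun j => by simp only [r, pow_mul]
  refine hmem ρ hρ (b 0) ξ (fun j => b (T * j)) rfl (fun j => hrT j ▸ hξn (T * j)) fun j => ?_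
  rw [← hrT]
  set cj := c ρ (b 0) j (b (T * j)) with hcj
  change _ ≤ |F j ξ + cj|
  have hstart : 0 ≤ s j * (F j (b (T * j)) + cj) := by
    change 0 ≤ (if 0 ≤ F j (b (T * j)) + cj then (1 : ℝ) else -1) * (F j (b (T * j)) + cj)
    split_ifs with h
    · simpa using h
    · linarith [not_le.1 h]
  -- White gains `(1 - α) r`, and Black can take back at most `(α - αβ) r`, so the signed distance
  -- of the centre grows by at least `(1 + αβ - 2α) r`.
  have hstep : ∀ m < T, s j * (F j (b (T * j + m)) + cj) + (1 + α * β - 2 * α) * r (T * j + m) ≤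
      s j * (F j (b (T * j + m + 1)) + cj) := by
    intro m hm
    have hdiv : (T * j + m) / T = j := by
      rw [Nat.mul_add_div hT0, Nat.div_eq_of_lt hm, add_zero]
    set n := T * j + m
    -- the point of Black's next ball farthest towards the hyperplane
    have hy : translate (b (n + 1))
        ((-(s j * r (n + 1))) • u ρ (b 0) j (b (T * j))) ∈ ball A N (w n) (α * r n) := by
      refine hblack n ?_
      change N ((-(s j * r (n + 1))) • U j + b (n + 1) - b (n + 1)) ≤ r (n + 1)
      rw [add_sub_cancel_right, map_smul_eq_mul, Real.norm_eq_abs, abs_neg, abs_mul, hs, one_mul,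
        abs_of_pos (hrpos _)]
      nlinarith [hU j, hrpos (n + 1)]
    have hy' : N ((-(s j * r (n + 1))) • U j + b (n + 1) - w n) ≤ α * r n := hy
    have hbw : (-(s j * r (n + 1))) • U j + (b (n + 1) : Fin d → ℝ) - w n ∈ A.direction := by
      rw [add_sub_assoc]
      exact A.direction.add_mem (A.direction.smul_mem _ (hUmem j))
        (AffineSubspace.vsub_mem_direction (b (n + 1)).2 (w n).2)
    have h1 := (hF j _ hbw).trans hy'
    rw [hw, hdiv] at h1
    simp only [map_sub, map_add, map_smul, hFU, smul_eq_mul, mul_one] at h1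
    have h2 : |s j * (-(s j * r (n + 1)) + F j (b (n + 1)) -
        (s j * ((1 - α) * r n) + F j (b n)))| ≤ α * r n := by
      rwa [abs_mul, hs, one_mul]
    have h3 := (abs_le.1 h2).1
    have h4 : s j * (-(s j * r (n + 1)) + F j (b (n + 1)) - (s j * ((1 - α) * r n) + F j (b n))) =
        s j * F j (b (n + 1)) - s j * F j (b n) - (s j * s j) * (r (n + 1) + (1 - α) * r n) := by
      ring
    rw [h4, hss, hrs] at h3
    nlinarith
  have hiter : ∀ m < T, (1 + α * β - 2 * α) * r (T * j) ≤
      s j * (F j (b (T * j + m + 1)) + cj) := by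
    intro m
    induction m with
    | zero =>
      intro h
      have := hstep 0 h
      simp only [add_zero] at this ⊢
      linarith
    | succ m ih =>
      intro h
      have h1 := hstep (m + 1) h
      have h2 := ih (by omega)
      have h3 := mul_pos hαβ (hrpos (T * j + (m + 1)))
      rw [← add_assoc] at h1 h3
      simp only [← add_assoc] at h1 h3 ⊢
      linarith
  have hend : (1 + α * β - 2 * α) * r (T * j) ≤ s j * (F j (b (T * j + T)) + cj) := by
    have := hiter (T - 1) (by omega)
    rwa [add_assoc, Nat.sub_add_cancel hT0] at this
  have hdist : |s j * F j (ξ - b (T * j + T))| ≤ r (T * j + T) := by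
    rw [abs_mul, hs, one_mul]
    exact (hF j _ (AffineSubspace.vsub_mem_direction ξ.2 (b (T * j + T)).2)).trans (hξn _)
  -- `T` was chosen so that the last ball of the block uses up at most half of the distance gained
  -- by its centre.
  have hrTT : r (T * j + T) ≤ (1 + α * β - 2 * α) / 2 * r (T * j) := by
    have : r (T * j + T) = (α * β) ^ T * r (T * j) := by simp only [r, pow_add]; ring
    rw [this]
    exact mul_le_mul_of_nonneg_right hT.le (hrpos _).le
  have h5 := (abs_le.1 hdist).1
  rw [map_sub] at h5
  calc (1 + α * β - 2 * α) / 2 * r (T * j) ≤ s j * (F j ξ + cj) := by nlinarith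
    _ ≤ |s j * (F j ξ + cj)| := le_abs_self _
    _ = |F j ξ + cj| := by rw [abs_mul, hs, one_mul]

end Game

end AffineApprox

/-! ### Determinants and integer relations -/

namespace AffineApprox

open Matrix

theorem abs_det_le_factorial_mul_prod {n : Type*} [Fintype n] [DecidableEq n] {M : Matrix n n ℝ}
    {B : n → ℝ} (h : ∀ i k, |M i k| ≤ B i) :
    |M.det| ≤ (Fintype.card n).factorial * ∏ i, B i := by
  rw [det_apply']
  calc |∑ σ : Equiv.Perm n, ((Equiv.Perm.sign σ : ℤ) : ℝ) * ∏ i, M (σ i) i|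
      ≤ ∑ σ : Equiv.Perm n, |((Equiv.Perm.sign σ : ℤ) : ℝ) * ∏ i, M (σ i) i| :=
        Finset.abs_sum_le_sum_abs _ _
    _ ≤ ∑ _σ : Equiv.Perm n, ∏ i, B i := by
        refine Finset.sum_le_sum fun σ _ => ?_
        rw [abs_mul, Finset.abs_prod]
        have h1 : |((Equiv.Perm.sign σ : ℤ) : ℝ)| = 1 := by
          rcases Int.units_eq_one_or (Equiv.Perm.sign σ) with h | h <;> simp [h]
        rw [h1, one_mul, ← Equiv.prod_comp σ B]
        exact Finset.prod_le_prod (fun i _ => abs_nonneg _) fun i _ => h _ _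
    _ = (Fintype.card n).factorial * ∏ i, B i := by
        simp [Finset.card_univ, Fintype.card_perm]

/-- A determinant whose rows are close to multiples of a fixed vector is small. -/
theorem abs_det_le_of_rows_near_multiples {n : Type*} [Fintype n] [DecidableEq n] [Nonempty n]
    {M : Matrix n n ℝ} {q y : n → ℝ} {Q Y s : ℝ} (hq : ∀ i, 1 ≤ q i) (hqQ : ∀ i, q i ≤ Q)
    (hy : ∀ k, |y k| ≤ Y) (hM : ∀ i k, |M i k - q i * y k| ≤ s) :
    |M.det| ≤ (Fintype.card n).factorial *
      ((Q * Y + s) * (2 * s) ^ (Fintype.card n - 1)) := by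
  obtain ⟨i₀, hi₀⟩ := Finite.exists_max q
  have hq₀ : 0 < q i₀ := one_pos.trans_le (hq i₀)
  have hs : 0 ≤ s := (abs_nonneg _).trans (hM i₀ i₀)
  -- Row `i₀` has the largest `q`, so the multipliers are at most one. Subtracting its multiples
  -- cancels the main terms and leaves entries at most `2s` in the other rows.
  let c : n → ℝ := fun i => if i = i₀ then 0 else q i / q i₀
  let B : Matrix n n ℝ := of fun i k => M i k - c i * M i₀ k
  have hdet : M.det = B.det := by
    refine det_eq_of_forall_row_eq_smul_add_const c i₀ (by simp [c]) fun i k => ?_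
    simp [B, c]
  rw [hdet]
  have hprod : ∏ i, (if i = i₀ then Q * Y + s else 2 * s) =
      (Q * Y + s) * (2 * s) ^ (Fintype.card n - 1) := by
    rw [← Finset.mul_prod_erase _ _ (Finset.mem_univ i₀)]
    congr 1
    · simp
    · rw [Finset.prod_congr rfl (g := fun _ => 2 * s)
        (fun i hi => if_neg (Finset.ne_of_mem_erase hi)), Finset.prod_const,
        Finset.card_erase_of_mem (Finset.mem_univ _), Finset.card_univ]
  rw [← hprod]
  refine abs_det_le_factorial_mul_prod fun i k => ?_
  simp only [B, of_apply, c]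
  by_cases hi : i = i₀
  · subst hi
    simp only [if_true, zero_mul, sub_zero]
    have h1 : |M i k| ≤ |M i k - q i * y k| + |q i * y k| := by
      simpa using abs_add_le (M i k - q i * y k) (q i * y k)
    have h2 : |q i * y k| ≤ Q * Y := by
      rw [abs_mul, abs_of_pos hq₀]
      exact mul_le_mul (hqQ i) (hy k) (abs_nonneg _) (hq₀.le.trans (hqQ i))
    linarith [hM i k]
  · simp only [if_neg hi]
    have h1 : M i k - q i / q i₀ * M i₀ k =
        (M i k - q i * y k) - q i / q i₀ * (M i₀ k - q i₀ * y k) := by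
      field_simp
      ring
    rw [h1]
    have h2 : |q i / q i₀| ≤ 1 := by
      rw [abs_of_pos (div_pos (one_pos.trans_le (hq i)) hq₀), div_le_one hq₀]
      exact hi₀ i
    have h3 : |q i / q i₀ * (M i₀ k - q i₀ * y k)| ≤ s := by
      rw [abs_mul]
      nlinarith [hM i₀ k, abs_nonneg (M i₀ k - q i₀ * y k), abs_nonneg (q i / q i₀)]
    have h4 := abs_sub (M i k - q i * y k) (q i / q i₀ * (M i₀ k - q i₀ * y k))
    linarith [hM i k]

/-- Linearly independent rows have a non-vanishing maximal minor. -/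
theorem exists_minor_ne_zero {m n : ℕ} {v : Fin m → Fin n → ℝ} (hv : LinearIndependent ℝ v) :
    ∃ g : Fin m → Fin n, (of fun i k => v i (g k)).det ≠ 0 := by
  let M : Matrix (Fin m) (Fin n) ℝ := of v
  have hrank : M.rank = m := by simpa using LinearIndependent.rank_matrix (M := M) hv
  rw [rank_eq_finrank_span_cols] at hrank
  obtain ⟨w, hw, -, hli⟩ := Submodule.exists_fun_fin_finrank_span_eq ℝ (Set.range M.col)
  choose g hg using hw
  let e := finCongr hrank.symm
  refine ⟨fun k => g (e k), ?_⟩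
  have h : LinearIndependent ℝ (of fun i k => v i (g (e k)) : Matrix (Fin m) (Fin m) ℝ).col := by
    have hcol : (of fun i k => v i (g (e k)) : Matrix (Fin m) (Fin m) ℝ).col = w ∘ e :=
      funext fun k => hg (e k)
    rw [hcol]
    exact hli.comp e e.injective
  exact (isUnit_iff_isUnit_det _).1 (linearIndependent_cols_iff_isUnit.1 h) |>.ne_zero

/-- The map `(c, e) ↦ (c, c x₀ + e)` embeds `ℝ × A.direction` in the cone. -/
theorem finrank_direction_lt_finrank_cone {d : ℕ} {A : AffineSubspace ℝ (Fin d → ℝ)}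
    (x₀ : A) : Module.finrank ℝ A.direction + 1 ≤ Module.finrank ℝ (cone A) := by
  have hx : (Fin.cons 1 (x₀ : Fin d → ℝ) : Fin (d + 1) → ℝ) ∈ cone A :=
    Submodule.subset_span ⟨x₀, x₀.2, rfl⟩
  have hdir : ∀ e ∈ A.direction, (Fin.cons 0 e : Fin (d + 1) → ℝ) ∈ cone A := by
    intro e he
    have h1 : (Fin.cons 1 (e + (x₀ : Fin d → ℝ)) : Fin (d + 1) → ℝ) ∈ cone A :=
      Submodule.subset_span ⟨_, AffineSubspace.vadd_mem_of_mem_direction he x₀.2, rfl⟩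
    convert (cone A).sub_mem h1 hx using 1
    ext i
    refine Fin.cases ?_ (fun i => ?_) i <;> simp
  let T : ℝ × A.direction →ₗ[ℝ] (Fin (d + 1) → ℝ) :=
    { toFun := fun p => Fin.cons p.1 (p.1 • (x₀ : Fin d → ℝ) + p.2)
      map_add' := fun p q => by
        ext i
        refine Fin.cases ?_ (fun i => ?_) i
        · simp
        · simp; ring
      map_smul' := fun c p => by
        ext i
        refine Fin.cases ?_ (fun i => ?_) i
        · simp
        · simp; ring }
  have hT : ∀ p, T p ∈ cone A := by
    intro p
    have h : T p = p.1 • Fin.cons 1 (x₀ : Fin d → ℝ) + Fin.cons 0 (p.2 : Fin d → ℝ) := by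
      ext i
      refine Fin.cases ?_ (fun i => ?_) i <;> simp [T]
    rw [h]
    exact (cone A).add_mem ((cone A).smul_mem _ hx) (hdir _ p.2.2)
  have hinj : Function.Injective (T.codRestrict (cone A) hT) := by
    rw [← LinearMap.ker_eq_bot, LinearMap.ker_codRestrict, LinearMap.ker_eq_bot']
    rintro ⟨c, e⟩ h
    have h0 : c = 0 := by simpa [T] using congr_fun h 0
    subst h0
    refine Prod.ext rfl (Subtype.ext (funext fun i => ?_))
    simpa [T] using congr_fun h i.succ
  have := LinearMap.finrank_le_finrank_of_injective hinj
  rw [Module.finrank_prod, Module.finrank_self] at this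
  omega

/-- If `A` has too few integer points, then any `a + 1` independent integer vectors with small
maximal minors satisfy an integer relation with small coefficients which is not a relation
on `A`. -/
theorem exists_integer_relation {d a : ℕ} {A : AffineSubspace ℝ (Fin d → ℝ)}
    (hA : Module.finrank ℝ A.direction = a) (x₀ : A) (hΓ : latticeDim A ≤ a)
    {v : Fin (a + 1) → Fin (d + 1) → ℤ} (hv : LinearIndependent ℝ fun i k => (v i k : ℝ)) {K : ℝ}
    (hK : ∀ g : Fin (a + 1) → Fin (d + 1), |(of fun i k => (v i (g k) : ℝ)).det| ≤ K) :
    ∃ h : Fin (d + 1) → ℤ, (∀ k, |(h k : ℝ)| ≤ (a + 2) * K) ∧ (∀ i, ∑ k, h k * v i k = 0) ∧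
      ∃ ξ ∈ A, ∑ k, (h k : ℝ) * (Fin.cons 1 ξ : Fin (d + 1) → ℝ) k ≠ 0 := by
  obtain ⟨g, hg⟩ := exists_minor_ne_zero hv
  let V : Matrix (Fin (a + 1)) (Fin (a + 1)) ℤ := of fun i k => v i (g k)
  have cast_det : ∀ W : Matrix (Fin (a + 1)) (Fin (a + 1)) ℤ,
      ((W.det : ℤ) : ℝ) = (W.map ((↑) : ℤ → ℝ)).det := fun W => by
    simpa using (Int.castRingHom ℝ).map_det W
  have hVdet : ((V.det : ℤ) : ℝ) ≠ 0 := by rw [cast_det]; exact hg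
  let c : Fin (d + 1) → Fin (a + 1) → ℤ := fun j => cramer V fun i => v i j
  -- The relation `h j` expresses coordinate `j` through the coordinates `g i`, with denominators
  -- cleared by `V.det`.
  let h : Fin (d + 1) → Fin (d + 1) → ℤ := fun j k =>
    V.det * (if k = j then 1 else 0) - ∑ i, c j i * (if k = g i then 1 else 0)
  have hsumR : ∀ (j) (x : Fin (d + 1) → ℝ), ∑ k, (h j k : ℝ) * x k =
      (V.det : ℝ) * x j - ∑ i, (c j i : ℝ) * x (g i) := by
    intro j x
    simp only [h, Int.cast_sub, Int.cast_mul, Int.cast_sum, sub_mul, Finset.sum_sub_distrib,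
      Finset.sum_mul]
    congr 1
    · simp
    · rw [Finset.sum_comm]
      simp
  have hzero : ∀ j i, ∑ k, h j k * v i k = 0 := by
    intro j i
    have h1 := hsumR j fun k => (v i k : ℝ)
    have h2 : ∑ l, v i (g l) * c j l = V.det * v i j := congr_fun (mulVec_cramer V fun i => v i j) i
    have h3 : (∑ l, (c j l : ℝ) * (v i (g l) : ℝ)) = (V.det : ℝ) * v i j := by
      rw [← Int.cast_mul, ← h2]
      push_cast
      exact Finset.sum_congr rfl fun l _ => mul_comm _ _
    rw [h3, sub_self] at h1
    exact_mod_cast h1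
  have hcK : ∀ j l, |(c j l : ℝ)| ≤ K := by
    intro j l
    -- The Cramer coefficients are themselves maximal minors, so `K` bounds them too.
    have : c j l = (of fun i k => v i (Function.update g l j k)).det := by
      simp only [c, cramer_apply]
      congr 1
      ext i k
      by_cases hk : k = l
      · subst hk; simp
      · simp [hk, V]
    rw [this, cast_det]
    exact hK _
  have hdK : |(V.det : ℝ)| ≤ K := by rw [cast_det]; exact hK g
  have hK0 : 0 ≤ K := (abs_nonneg _).trans hdK
  have hbound : ∀ j k, |(h j k : ℝ)| ≤ (a + 2) * K := by
    intro j k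
    have e1 : (h j k : ℝ) = (V.det : ℝ) * (if k = j then 1 else 0) -
        ∑ i, (c j i : ℝ) * (if k = g i then 1 else 0) := by
      simp only [h]; push_cast; rfl
    rw [e1]
    have e2 : |(V.det : ℝ) * (if k = j then 1 else 0)| ≤ K := by
      split_ifs <;> simp [hdK, hK0]
    have e3 : |∑ i, (c j i : ℝ) * (if k = g i then 1 else 0)| ≤ (a + 1) * K := by
      refine (Finset.abs_sum_le_sum_abs _ _).trans ?_
      calc ∑ i, |(c j i : ℝ) * (if k = g i then 1 else 0)| ≤ ∑ _i : Fin (a + 1), K := by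
            refine Finset.sum_le_sum fun i _ => ?_
            split_ifs <;> simp [hcK, hK0]
        _ = (a + 1) * K := by simp
    have e4 := abs_sub ((V.det : ℝ) * (if k = j then 1 else 0))
      (∑ i, (c j i : ℝ) * (if k = g i then 1 else 0))
    linarith
  -- If every `h j` vanished on `A`, each `(1, ξ)` would be determined by its coordinates `g i` and
  -- so lie in the span of the `v i`. Comparing dimensions, the cone would equal this span and all
  -- `v i` would lie in `Γ(A)`.
  by_contra hcon
  push Not at hcon
  have hvan : ∀ j, ∀ ξ ∈ A, ∑ k, (h j k : ℝ) * (Fin.cons 1 ξ : Fin (d + 1) → ℝ) k = 0 :=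
    fun j => hcon (h j) (hbound j) (hzero j)
  have hinv : IsUnit (of fun i k => (v i (g k) : ℝ)) := (isUnit_iff_isUnit_det _).2 hg.isUnit
  have hle : cone A ≤ Submodule.span ℝ (Set.range fun i k => (v i k : ℝ)) := by
    refine Submodule.span_le.2 ?_
    rintro _ ⟨ξ, hξ, rfl⟩
    set x : Fin (d + 1) → ℝ := Fin.cons 1 ξ
    obtain ⟨z, hz⟩ := (vecMul_surjective_iff_isUnit.2 hinv) fun k => x (g k)
    have hx : x = ∑ i, z i • fun k => (v i k : ℝ) := by
      ext j
      have h1 : ∑ k, (h j k : ℝ) * x k = 0 := hvan j ξ hξ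
      rw [hsumR] at h1
      have h2 : ∀ l, x (g l) = ∑ i, z i * (v i (g l) : ℝ) := fun l => (congr_fun hz l).symm
      have h3 : ∀ i, ∑ l, (c j l : ℝ) * (v i (g l) : ℝ) = (V.det : ℝ) * v i j := by
        intro i
        have h4 := hsumR j fun k => (v i k : ℝ)
        have h5 : ∑ k, (h j k : ℝ) * (v i k : ℝ) = 0 := by exact_mod_cast hzero j i
        linarith
      have h6 : (V.det : ℝ) * x j = V.det * ∑ i, z i * (v i j : ℝ) := by
        rw [sub_eq_zero.1 h1]
        simp only [h2, Finset.mul_sum]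
        rw [Finset.sum_comm]
        refine Finset.sum_congr rfl fun i _ => ?_
        rw [mul_left_comm, ← h3, Finset.mul_sum]
        exact Finset.sum_congr rfl fun l _ => by ring
      simpa using mul_left_cancel₀ hVdet h6
    rw [hx]
    exact Submodule.sum_mem _ fun i _ => Submodule.smul_mem _ _ (Submodule.subset_span ⟨i, rfl⟩)
  have hfr : Module.finrank ℝ (Submodule.span ℝ (Set.range fun i k => (v i k : ℝ))) = a + 1 := by
    simpa using finrank_span_eq_card hv
  have hcone := finrank_direction_lt_finrank_cone x₀
  have heq := Submodule.eq_of_le_of_finrank_le hle (by rw [hfr, ← hA]; exact hcone)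
  have hlat : Submodule.span ℝ (Set.range fun i k => (v i k : ℝ)) ≤
      Submodule.span ℝ (lattice A) := by
    refine Submodule.span_mono ?_
    rintro _ ⟨i, rfl⟩
    refine ⟨?_, v i, fun _ => rfl⟩
    rw [heq]
    exact Submodule.subset_span ⟨i, rfl⟩
  have := Submodule.finrank_mono hlat
  rw [hfr] at this
  have h' : a + 1 ≤ latticeDim A := this
  omega

end AffineApprox

/-! ### Hyperplanes of `A` defined by integer vectors -/

namespace AffineApprox

variable {d : ℕ} {A : AffineSubspace ℝ (Fin d → ℝ)} {N : Seminorm ℝ (Fin d → ℝ)}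

/-- `p = (f, c, u)` is an affine form `f + c` whose linear part has norm one on the direction of `A`,
together with a vector `u` at which the norm is attained. -/
def IsUnitForm (N : Seminorm ℝ (Fin d → ℝ)) (A : AffineSubspace ℝ (Fin d → ℝ))
    (p : ((Fin d → ℝ) →ₗ[ℝ] ℝ) × ℝ × A.direction) : Prop :=
  (∀ e ∈ A.direction, |p.1 e| ≤ N e) ∧ N p.2.2 ≤ 1 ∧ p.1 p.2.2 = 1

theorem exists_isUnitForm (hN : ∀ x, N x = 0 → x = 0) (f : (Fin d → ℝ) →ₗ[ℝ] ℝ) (c : ℝ)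
    (hf : ∃ e ∈ A.direction, f e ≠ 0) :
    ∃ m : ℝ, 0 < m ∧ ∃ p, IsUnitForm N A p ∧ ∀ x, p.1 x + p.2.1 = m⁻¹ * (f x + c) := by
  obtain ⟨m, hm, hfm, u, hu, hu1, hfu⟩ := exists_normalized_form hN f hf
  refine ⟨m, hm, (m⁻¹ • f, m⁻¹ * c, ⟨u, hu⟩), ⟨fun e he => ?_, hu1, ?_⟩, fun x => ?_⟩
  · simp only [LinearMap.smul_apply, smul_eq_mul, abs_mul, abs_inv, abs_of_pos hm]
    rw [inv_mul_eq_div, div_le_iff₀ hm]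
    linarith [hfm e he]
  · simp [hfu, hm.ne']
  · simp [mul_add]

theorem exists_isUnitForm_of_direction_ne_bot (hN : ∀ x, N x = 0 → x = 0)
    (hA : A.direction ≠ ⊥) : ∃ p, IsUnitForm N A p := by
  obtain ⟨e, he, he0⟩ := A.direction.ne_bot_iff.1 hA
  obtain ⟨i, hi⟩ := Function.ne_iff.1 he0
  obtain ⟨m, -, p, hp, -⟩ := exists_isUnitForm (A := A) hN (LinearMap.proj i) 0 ⟨e, he, hi⟩
  exact ⟨p, hp⟩

/-- The value at `(1, x)` of the linear form with coefficients `h`. -/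
def relation (h : Fin (d + 1) → ℤ) (x : Fin d → ℝ) : ℝ :=
  ∑ k, (h k : ℝ) * (Fin.cons 1 x : Fin (d + 1) → ℝ) k

theorem relation_eq (h : Fin (d + 1) → ℤ) (x : Fin d → ℝ) :
    relation h x = h 0 + ∑ k, (h (Fin.succ k) : ℝ) * x k := by
  simp [relation, Fin.sum_univ_succ]

/-- Normalizing the relation scales it by the norm `m` of its linear part on the direction of `A`.
If that part is zero, the relation is constant on `A`: any unit form will do, and `τ ≤ 1` makes the
constant itself a valid bound. -/
theorem exists_isUnitForm_relation (hN : ∀ x, N x = 0 → x = 0) (hA : A.direction ≠ ⊥)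
    (h : Fin (d + 1) → ℤ) :
    ∃ p, IsUnitForm N A p ∧ ((∃ x ∈ A, relation h x ≠ 0) → ∃ m : ℝ, 0 < m ∧ ∀ ξ ∈ A, ∀ τ : ℝ,
      τ ≤ 1 → τ ≤ |p.1 ξ + p.2.1| → m * τ ≤ |relation h ξ|) := by
  let f : (Fin d → ℝ) →ₗ[ℝ] ℝ := ∑ k, (h (Fin.succ k) : ℝ) • LinearMap.proj k
  have hf : ∀ x, relation h x = f x + h 0 := by
    intro x
    rw [relation_eq, add_comm]
    simp [f, LinearMap.sum_apply]
  by_cases hfe : ∃ e ∈ A.direction, f e ≠ 0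
  · obtain ⟨m, hm, p, hp, hpf⟩ := exists_isUnitForm hN f (h 0) hfe
    refine ⟨p, hp, fun _ => ⟨m, hm, fun ξ _ τ _ hτ => ?_⟩⟩
    rw [hpf, ← hf, abs_mul, abs_inv, abs_of_pos hm, inv_mul_eq_div, le_div_iff₀ hm] at hτ
    linarith
  · push Not at hfe
    obtain ⟨p, hp⟩ := exists_isUnitForm_of_direction_ne_bot hN hA
    refine ⟨p, hp, ?_⟩
    rintro ⟨x, hx, hx0⟩
    refine ⟨|relation h x|, abs_pos.2 hx0, fun ξ hξ τ hτ _ => ?_⟩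
    have : relation h ξ = relation h x := by
      have h1 := hfe (ξ - x) (AffineSubspace.vsub_mem_direction hξ hx)
      rw [map_sub] at h1
      rw [hf, hf]
      linarith
    rw [this]
    exact mul_le_of_le_one_right (abs_nonneg _) hτ

/-- The displacement `p - q x` of the integer vector `(q, p)` from the multiple `q (1, x)`. -/
def displacement (v : Fin (d + 1) → ℤ) (x : Fin d → ℝ) : Fin d → ℝ :=
  fun i => (v i.succ : ℝ) - v 0 * x i

/-- Integer vectors that span a space of dimension at most `dim A` project to a hyperplane
of `A`. -/
theorem exists_isUnitForm_of_finrank_span_le (hN : ∀ x, N x = 0 → x = 0) (hA : A.direction ≠ ⊥)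
    (x₀ : A) (P : (Fin d → ℝ) →ₗ[ℝ] A.direction) (hP : ∀ e : A.direction, P e = e)
    {S : Set (Fin (d + 1) → ℤ)} (hS : ∀ v ∈ S, 0 < v 0)
    (hfr : Module.finrank ℝ (Submodule.span ℝ
      ((fun (v : Fin (d + 1) → ℤ) k => (v k : ℝ)) '' S)) ≤ Module.finrank ℝ A.direction) :
    ∃ p, IsUnitForm N A p ∧ ∀ v ∈ S, ∀ ξ ∈ A,
      |p.1 ξ + p.2.1| * v 0 ≤ N (P (displacement v ξ)) := by
  rcases S.eq_empty_or_nonempty with rfl | ⟨v₀, hv₀⟩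
  · obtain ⟨p, hp⟩ := exists_isUnitForm_of_direction_ne_bot hN hA
    exact ⟨p, hp, by simp⟩
  let T₀ : (Fin (d + 1) → ℝ) →ₗ[ℝ] (Fin d → ℝ) :=
    LinearMap.pi fun i => LinearMap.proj i.succ - (x₀ : Fin d → ℝ) i • LinearMap.proj 0
  -- The target has dimension `dim A + 1`, so the image of `W` is proper and is killed by a nonzero
  -- functional `φ`.
  let T : (Fin (d + 1) → ℝ) →ₗ[ℝ] ℝ × A.direction := (LinearMap.proj 0).prod (P ∘ₗ T₀)
  set W := Submodule.span ℝ ((fun (v : Fin (d + 1) → ℤ) k => (v k : ℝ)) '' S) with hW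
  have hlt : W.map T < ⊤ := by
    refine lt_top_iff_ne_top.2 fun h => ?_
    have h1 := Submodule.finrank_map_le T W
    rw [h, finrank_top, Module.finrank_prod, Module.finrank_self] at h1
    omega
  obtain ⟨φ, hφ, hker⟩ := Submodule.exists_le_ker_of_lt_top _ hlt
  have hvan : ∀ v ∈ S, φ ((v 0 : ℝ), P (displacement v x₀)) = 0 := by
    intro v hv
    have hmem : T (fun k => (v k : ℝ)) ∈ W.map T :=
      Submodule.mem_map_of_mem (Submodule.subset_span ⟨v, hv, rfl⟩)
    have h1 := LinearMap.mem_ker.1 (hker hmem)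
    have h2 : T (fun k => (v k : ℝ)) = ((v 0 : ℝ), P (displacement v x₀)) := by
      refine Prod.ext rfl ?_
      change P _ = P _
      congr 1
      ext i
      simp [T₀, displacement, mul_comm]
    rwa [h2] at h1
  let g : A.direction →ₗ[ℝ] ℝ := φ ∘ₗ LinearMap.inr ℝ ℝ A.direction
  have hφg : ∀ c e, φ (c, e) = c * φ (1, 0) + g e := by
    intro c e
    have : ((c, e) : ℝ × A.direction) = c • ((1, 0) : ℝ × A.direction) + (0, e) := by simp
    rw [this, map_add, map_smul]
    rfl
  -- If `φ` depended on the first coordinate only, its vanishing at a vector with `v₀ 0 > 0` would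
  -- force `φ = 0`.
  have hg : ∃ e ∈ A.direction, (g ∘ₗ P) e ≠ 0 := by
    by_contra hcon
    push Not at hcon
    have hg0 : ∀ e, g e = 0 := fun e => by
      have := hcon e e.2
      rwa [LinearMap.comp_apply, hP] at this
    have h1 := hvan v₀ hv₀
    rw [hφg, hg0, add_zero] at h1
    have h2 : (v₀ 0 : ℝ) ≠ 0 := by exact_mod_cast (hS v₀ hv₀).ne'
    have h3 := (mul_eq_zero.1 h1).resolve_left h2
    refine hφ (LinearMap.ext fun ⟨c, e⟩ => ?_)
    rw [hφg, h3, hg0]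
    simp
  -- The constant makes the form at `ξ ∈ A` equal to `φ (1, ξ - x₀)`, up to the factor `m⁻¹`.
  obtain ⟨m, hm, p, hp, hpf⟩ := exists_isUnitForm hN (g ∘ₗ P) (φ (1, 0) - g (P x₀)) hg
  refine ⟨p, hp, fun v hv ξ hξ => ?_⟩
  have hd : displacement v ξ = displacement v x₀ - (v 0 : ℝ) • (ξ - x₀) := by
    ext i
    simp [displacement]
    ring
  have h1 := hvan v hv
  rw [hφg] at h1
  have h2 : (p.1 ξ + p.2.1) * v 0 = -(m⁻¹ * g (P (displacement v ξ))) := by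
    rw [hpf, hd]
    simp only [LinearMap.comp_apply, map_sub, map_smul, smul_eq_mul]
    linear_combination m⁻¹ * h1
  have h3 : p.1 (P (displacement v ξ)) = m⁻¹ * g (P (displacement v ξ)) := by
    have e1 := hpf (P (displacement v ξ))
    have e2 := hpf 0
    rw [LinearMap.comp_apply, hP] at e1
    rw [map_zero, map_zero] at e2
    linarith
  have hv0 : (0 : ℝ) < v 0 := by exact_mod_cast hS v hv
  rw [← abs_of_pos hv0, ← abs_mul, h2, abs_neg, ← h3]
  exact hp.1 _ (P (displacement v ξ)).2

theorem exists_linearIndependent_of_lt_finrank_span {S : Set (Fin (d + 1) → ℤ)} {a : ℕ}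
    (h : a < Module.finrank ℝ (Submodule.span ℝ
      ((fun (v : Fin (d + 1) → ℤ) k => (v k : ℝ)) '' S))) :
    ∃ v : Fin (a + 1) → Fin (d + 1) → ℤ, (∀ i, v i ∈ S) ∧
      LinearIndependent ℝ fun i k => (v i k : ℝ) := by
  obtain ⟨w, hw, -, hli⟩ := Submodule.exists_fun_fin_finrank_span_eq ℝ
    ((fun (v : Fin (d + 1) → ℤ) k => (v k : ℝ)) '' S)
  choose v hv hvw using hw
  refine ⟨fun i => v (Fin.castLE h i), fun i => hv _, ?_⟩
  have : (fun (i : Fin (a + 1)) k => (v (Fin.castLE h i) k : ℝ)) = w ∘ Fin.castLE h :=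
    funext fun i => hvw _
  rw [this]
  exact hli.comp _ (Fin.castLE_injective h)

/-- The maximal minors of integer vectors of height `q`, `q ^ (1 + 1 / a) ≤ X`, in the cone over
a ball of radius `c r`. -/
theorem abs_minor_le {a : ℕ} (ha : 0 < a) {v : Fin (a + 1) → Fin (d + 1) → ℤ} {x : Fin d → ℝ}
    {X Y c r ρ : ℝ} (hc : 0 ≤ c) (hr : 0 ≤ r) (hrρ : r ≤ ρ) (hY : 1 ≤ Y) (hx : ‖x‖ ≤ Y)
    (hv : ∀ i, 1 ≤ v i 0) (hvX : ∀ i, (v i 0 : ℝ) ^ (1 + 1 / (a : ℝ)) ≤ X)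
    (hvx : ∀ i, ‖displacement (v i) x‖ ≤ c * (v i 0) * r) (g : Fin (a + 1) → Fin (d + 1)) :
    |(Matrix.of fun i k => (v i (g k) : ℝ)).det| ≤
      (a + 1).factorial * ((Y + c * ρ) * (2 * c) ^ a) * (X * r) ^ a := by
  have ha' : (0 : ℝ) < a := by exact_mod_cast ha
  have hv' : ∀ i, (1 : ℝ) ≤ v i 0 := fun i => by exact_mod_cast hv i
  have hX : 0 ≤ X := (Real.rpow_nonneg (zero_le_one.trans (hv' 0)) _).trans (hvX 0)
  -- `Q` is the height at which `Q ^ (1 + 1 / a) = X`. One row has size `O(Q)` and `a` rows have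
  -- size `O(Q r)` after reduction, giving `Q ^ (a + 1) * r ^ a = (X r) ^ a`.
  set Q := X ^ ((a : ℝ) / (a + 1)) with hQ
  have hQ0 : 0 ≤ Q := Real.rpow_nonneg hX _
  have hQX : Q ^ (a + 1) = X ^ a := by
    rw [hQ, ← Real.rpow_natCast, ← Real.rpow_mul hX, ← Real.rpow_natCast]
    congr 1
    push_cast
    field_simp
  have hvQ : ∀ i, (v i 0 : ℝ) ≤ Q := by
    intro i
    have h0 := zero_le_one.trans (hv' i)
    calc (v i 0 : ℝ) = ((v i 0 : ℝ) ^ (1 + 1 / (a : ℝ))) ^ ((a : ℝ) / (a + 1)) := by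
          rw [← Real.rpow_mul h0]
          have : (1 + 1 / (a : ℝ)) * ((a : ℝ) / (a + 1)) = 1 := by field_simp
          rw [this, Real.rpow_one]
      _ ≤ Q := Real.rpow_le_rpow (Real.rpow_nonneg h0 _) (hvX i) (by positivity)
  have hs : 0 ≤ c * Q * r := by positivity
  have hnear : ∀ i (j : Fin (d + 1)),
      |(v i j : ℝ) - v i 0 * (Fin.cons 1 x : Fin (d + 1) → ℝ) j| ≤ c * Q * r := by
    intro i j
    refine Fin.cases ?_ (fun j => ?_) j
    · simpa using hs
    · rw [Fin.cons_succ]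
      calc |(v i j.succ : ℝ) - v i 0 * x j| ≤ ‖displacement (v i) x‖ :=
            norm_le_pi_norm (displacement (v i) x) j
        _ ≤ c * (v i 0) * r := hvx i
        _ ≤ c * Q * r := by
            have := hvQ i
            gcongr
  have hcons : ∀ j : Fin (d + 1), |(Fin.cons 1 x : Fin (d + 1) → ℝ) j| ≤ Y := by
    intro j
    refine Fin.cases ?_ (fun j => ?_) j
    · simpa using hY
    · rw [Fin.cons_succ]
      exact (norm_le_pi_norm x j).trans hx
  have hdet := abs_det_le_of_rows_near_multiples
    (M := Matrix.of fun i k => (v i (g k) : ℝ)) (q := fun i => (v i 0 : ℝ))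
    (y := fun k => (Fin.cons 1 x : Fin (d + 1) → ℝ) (g k)) hv' hvQ (fun k => hcons _)
    (fun i k => hnear i (g k))
  rw [Fintype.card_fin, Nat.add_sub_cancel] at hdet
  refine hdet.trans ?_
  calc ((a + 1).factorial : ℝ) * ((Q * Y + c * Q * r) * (2 * (c * Q * r)) ^ a)
      ≤ (a + 1).factorial * ((Q * Y + c * Q * ρ) * (2 * (c * Q * r)) ^ a) := by gcongr
    _ = (a + 1).factorial * ((Y + c * ρ) * (2 * c) ^ a) * (Q ^ (a + 1) * r ^ a) := by ring
    _ = _ := by rw [hQX, ← mul_pow X r a]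

end AffineApprox

/-! ### Choice of the hyperplanes and the final estimate -/

namespace AffineApprox

open Filter

/-- If each `P · C` holds eventually, then `P i (C (i + 1))` holds eventually for some sequence `C`
that increases to infinity. -/
theorem exists_monotone_tendsto_eventually {P : ℕ → ℕ → Prop} (hP : ∀ c, ∀ᶠ i in atTop, P i c) :
    ∃ C : ℕ → ℕ, Monotone C ∧ Tendsto C atTop atTop ∧ ∀ᶠ i in atTop, P i (C (i + 1)) := by
  classical
  -- The shift makes `p (i + 1) c` give `P i c`. `Nat.findGreatest` falls back to `0`, which is
  -- harmless because `p n 0` holds for large `n`.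
  let p : ℕ → ℕ → Prop := fun n c => ∀ i, n ≤ i + 1 → P i c
  have hpm : ∀ {m n c}, m ≤ n → p m c → p n c := fun hmn h i hi => h i (hmn.trans hi)
  have hpe : ∀ c, ∃ n, p n c := fun c => by
    obtain ⟨n, hn⟩ := eventually_atTop.1 (hP c)
    exact ⟨n + 1, fun i hi => hn i (Nat.le_of_succ_le_succ hi)⟩
  refine ⟨fun n => Nat.findGreatest (p n) n, ?_, ?_, ?_⟩
  · intro m n hmn
    exact Nat.findGreatest_mono (fun c => hpm hmn) hmn
  · refine tendsto_atTop.2 fun c => ?_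
    obtain ⟨n, hn⟩ := hpe c
    filter_upwards [eventually_ge_atTop (max n c)] with k hk
    exact Nat.le_findGreatest ((le_max_right _ _).trans hk) (hpm ((le_max_left _ _).trans hk) hn)
  · obtain ⟨n, hn⟩ := hpe 0
    filter_upwards [eventually_ge_atTop n] with k hk
    exact Nat.findGreatest_spec (P := p (k + 1)) (Nat.zero_le _) (hpm (hk.trans k.le_succ) hn) k
      le_rfl

variable {d : ℕ} {A : AffineSubspace ℝ (Fin d → ℝ)} {N : Seminorm ℝ (Fin d → ℝ)}

/-- The consecutive ranges between `X i` and `X (i + 1)` cover all large `q`, and the bounds `C i`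
on them tend to infinity. -/
theorem mem_omegaStar_of_ranges {a : ℕ} {ξ : A} {X : ℕ → ℝ} {C : ℕ → ℕ}
    (hXm : Monotone X) (hX : Tendsto X atTop atTop) (hC : Tendsto C atTop atTop)
    (h : ∀ᶠ i in atTop, ∀ q : ℕ, X i < (q : ℝ) ^ (1 + 1 / (a : ℝ)) →
      (q : ℝ) ^ (1 + 1 / (a : ℝ)) ≤ X (i + 1) →
      (C i : ℝ) ≤ (q : ℝ) ^ ((1 : ℝ) / (a : ℝ)) *
        ⨆ k : Fin d, distInt ((q : ℝ) * (ξ : Fin d → ℝ) k)) :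
    ξ ∈ omegaStar A a := by
  refine tendsto_atTop.2 fun M => ?_
  have hM : ∀ᶠ i in atTop, M ≤ (C i : ℝ) :=
    (tendsto_natCast_atTop_atTop.comp hC).eventually_ge_atTop M
  obtain ⟨i₀, hi₀⟩ := eventually_atTop.1 (h.and hM)
  have hexp : (0 : ℝ) < 1 + 1 / (a : ℝ) := by positivity
  filter_upwards [((tendsto_rpow_atTop hexp).comp tendsto_natCast_atTop_atTop).eventually_gt_atTop
    (X i₀)] with q hq
  have hex : ∃ n, (q : ℝ) ^ (1 + 1 / (a : ℝ)) ≤ X n := (hX.eventually_ge_atTop _).exists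
  classical
  have hn := Nat.find_spec hex
  have hmin := fun m => Nat.find_min hex (m := m)
  generalize Nat.find hex = n at hn hmin
  have hlt : i₀ < n := by
    by_contra hle
    exact absurd (hn.trans (hXm (not_lt.1 hle))) (not_le.2 hq)
  obtain ⟨i, rfl⟩ : ∃ i, n = i + 1 := ⟨n - 1, by omega⟩
  obtain ⟨h1, h2⟩ := hi₀ i (by omega)
  exact h2.trans (h1 q (not_le.1 (hmin i (by omega))) hn)

theorem le_iSup_distInt {q : ℕ} {x : Fin d → ℝ} :
    ‖displacement (Fin.cons (q : ℤ) fun k => round ((q : ℝ) * x k)) x‖ ≤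
      ⨆ k : Fin d, distInt ((q : ℝ) * x k) := by
  have hnn : 0 ≤ ⨆ k : Fin d, distInt ((q : ℝ) * x k) :=
    Real.iSup_nonneg fun k => abs_nonneg _
  refine (pi_norm_le_iff_of_nonneg hnn).2 fun k => ?_
  refine le_trans (le_of_eq ?_) (le_ciSup (Set.finite_range _).bddAbove k)
  simp [displacement, distInt, abs_sub_comm]

/-- Only finitely many integer relations have bounded coefficients. -/
theorem finite_setOf_forall_abs_le (K : ℝ) :
    {h : Fin (d + 1) → ℤ | ∀ k, |(h k : ℝ)| ≤ K}.Finite := by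
  refine (Set.finite_Icc (fun _ : Fin (d + 1) => -⌈K⌉) fun _ => ⌈K⌉).subset fun h hh => ?_
  have h1 : ∀ k, |h k| ≤ ⌈K⌉ := fun k => by
    have : ((|h k| : ℤ) : ℝ) ≤ ⌈K⌉ := by
      rw [Int.cast_abs]
      exact (hh k).trans (Int.le_ceil K)
    exact_mod_cast this
  exact ⟨fun k => (abs_le.1 (h1 k)).1, fun k => (abs_le.1 (h1 k)).2⟩

/-- An integer relation of an integer vector `v` is nearly a relation of the points close to the
line through `v`. -/
theorem abs_relation_le {h v : Fin (d + 1) → ℤ} {x : Fin d → ℝ} {K s : ℝ}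
    (hh : ∀ k, |(h k : ℝ)| ≤ K) (hv : 0 < v 0) (hhv : ∑ k, h k * v k = 0) (hs : 0 ≤ s)
    (hvx : ‖displacement v x‖ ≤ v 0 * s) : |relation h x| ≤ (d + 1) * (K * s) := by
  have hv' : (0 : ℝ) < v 0 := by exact_mod_cast hv
  have hK : 0 ≤ K := (abs_nonneg _).trans (hh 0)
  -- As `h` annihilates `v`, only the error `v - v 0 (1, x)` contributes.
  have h1 : (v 0 : ℝ) * relation h x =
      -∑ k, (h k : ℝ) * ((v k : ℝ) - v 0 * (Fin.cons 1 x : Fin (d + 1) → ℝ) k) := by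
    have h2 : ∑ k, (h k : ℝ) * (v k : ℝ) = 0 := by exact_mod_cast hhv
    simp only [mul_sub, Finset.sum_sub_distrib, h2, relation, Finset.mul_sum]
    rw [zero_sub, neg_neg]
    exact Finset.sum_congr rfl fun k _ => by ring
  have h3 : ∀ k : Fin (d + 1),
      |(v k : ℝ) - v 0 * (Fin.cons 1 x : Fin (d + 1) → ℝ) k| ≤ v 0 * s := by
    intro k
    refine Fin.cases ?_ (fun k => ?_) k
    · simpa using mul_nonneg hv'.le hs
    · exact (norm_le_pi_norm (displacement v x) k).trans hvx
  have h4 : v 0 * |relation h x| ≤ v 0 * ((d + 1) * (K * s)) := by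
    rw [← abs_of_pos hv', ← abs_mul, h1, abs_neg, abs_of_pos hv']
    refine (Finset.abs_sum_le_sum_abs _ _).trans ?_
    calc ∑ k, |(h k : ℝ) * ((v k : ℝ) - v 0 * (Fin.cons 1 x : Fin (d + 1) → ℝ) k)|
        ≤ ∑ _k : Fin (d + 1), K * (v 0 * s) := by
          refine Finset.sum_le_sum fun k _ => ?_
          rw [abs_mul]
          exact mul_le_mul (hh k) (h3 k) (abs_nonneg _) hK
      _ = v 0 * ((d + 1) * (K * s)) := by
          simp only [Finset.sum_const, Finset.card_univ, Fintype.card_fin, nsmul_eq_mul]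
          push_cast
          ring
  exact le_of_mul_le_mul_left h4 hv'

theorem norm_displacement_le (v : Fin (d + 1) → ℤ) (hv : 0 ≤ v 0) (x y : Fin d → ℝ) :
    ‖displacement v y‖ ≤ ‖displacement v x‖ + v 0 * ‖x - y‖ := by
  have hv' : (0 : ℝ) ≤ v 0 := by exact_mod_cast hv
  have : displacement v y = displacement v x + (v 0 : ℝ) • (x - y) := by
    ext i
    simp [displacement]
    ring
  rw [this]
  refine (norm_add_le _ _).trans ?_
  rw [norm_smul, Real.norm_eq_abs, abs_of_nonneg hv']

/-- The order of choices matters: the lower bounds `δ h` come from the odd blocks and do not depend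
on `C`; then `C` is chosen slow enough in terms of `δ`; then `X` and the hyperplanes of the even
blocks are defined from `C`. -/
theorem exists_hyperplanes_omegaStar (hN : ∀ x, N x = 0 → x = 0) {a : ℕ} (ha : 0 < a)
    (hA : Module.finrank ℝ A.direction = a) (hΓ : latticeDim A ≤ a) {l κ ρ : ℝ} (hl : 0 < l)
    (hl1 : l < 1) (hκ : 0 < κ) (hρ : 0 < ρ) (x₀ : A) :
    ∃ D : ℕ → A → ((Fin d → ℝ) →ₗ[ℝ] ℝ) × ℝ × A.direction, (∀ j x, IsUnitForm N A (D j x)) ∧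
      ∀ (ξ : A) (x : ℕ → A), x 0 = x₀ → (∀ j, N ((ξ : Fin d → ℝ) - x j) ≤ l ^ j * ρ) →
        (∀ j, κ * (l ^ j * ρ) ≤ |(D j (x j)).1 ξ + (D j (x j)).2.1|) → ξ ∈ omegaStar A a := by
  classical
  have hdir : A.direction ≠ ⊥ := by
    intro h
    rw [h, finrank_bot] at hA
    omega
  obtain ⟨P, hP⟩ := A.direction.subtype.exists_leftInverse_of_injective A.direction.ker_subtype
  replace hP : ∀ e : A.direction, P e = e := fun e => LinearMap.congr_fun hP e
  obtain ⟨cN, hcN, hNn⟩ := norm_le_mul_seminorm hN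
  obtain ⟨cP, hcP, hPn⟩ := seminorm_le_mul_norm (N.comp (A.direction.subtype ∘ₗ P))
  replace hPn : ∀ z, N (P z) ≤ cP * ‖z‖ := hPn
  let r : ℕ → ℝ := fun i => l ^ (2 * i) * ρ
  have hrpos : ∀ i, 0 < r i := fun i => by positivity
  have hrρ : ∀ i, r i ≤ ρ := fun i => mul_le_of_le_one_left hρ.le (pow_le_one₀ hl.le hl1.le)
  have hrs : ∀ i, r (i + 1) = l ^ 2 * r i := fun i => by
    simp only [r, mul_add, mul_one, pow_add]; ring
  have hrlim : Tendsto r atTop (nhds 0) := by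
    have h := (tendsto_pow_atTop_nhds_zero_of_lt_one (sq_nonneg l)
      (by nlinarith : l ^ 2 < 1)).mul_const ρ
    simpa [r, pow_mul] using h
  -- the hyperplanes given by integer relations
  choose G hG hGrel using fun h => exists_isUnitForm_relation (N := N) (A := A) hN hdir h
  choose! m hm hGm using hGrel
  obtain ⟨δ, hδpos, hδ⟩ : ∃ δ : (Fin (d + 1) → ℤ) → ℝ,
      (∀ h, (∃ x ∈ A, relation h x ≠ 0) → 0 < δ h) ∧
      ∀ h, (∃ x ∈ A, relation h x ≠ 0) → ∀ ξ ∈ A,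
        κ * (l ^ (2 * Encodable.encode h + 1) * ρ) ≤ |(G h).1 ξ + (G h).2.1| →
          δ h ≤ |relation h ξ| := by
    refine ⟨fun h => m h * min 1 (κ * (l ^ (2 * Encodable.encode h + 1) * ρ)), fun h hh => ?_,
      fun h hh ξ hξ hle => ?_⟩
    · exact mul_pos (hm h hh) (lt_min one_pos (by positivity))
    · exact hGm h hh ξ hξ _ (min_le_left _ _) ((min_le_right _ _).trans hle)
  -- A counterexample `q` has displacement at most `(κ / cP) q r i` at `ξ`; passing from `ξ` to the
  -- centre adds at most `cN q r i`.
  let c₃ : ℝ := κ / cP + cN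
  have hc₃ : 0 < c₃ := by positivity
  -- This bounds the even-block centres of the play, uniformly and in advance: `ξ` is within `cN *
  -- ρ` of both `x₀` and each such centre.
  let Y : ℝ := 1 + ‖(x₀ : Fin d → ℝ)‖ + 2 * (cN * ρ)
  have hY : 1 ≤ Y := by
    have : 0 ≤ cN * ρ := by positivity
    have := norm_nonneg (x₀ : Fin d → ℝ)
    simp only [Y]
    linarith
  -- bounds for the minors and for the coefficients of relations at level `c`
  let K₀ : ℕ → ℝ := fun c => (a + 1).factorial * ((Y + c₃ * ρ) * (2 * c₃) ^ a) *
    (cP * (c + 1) / (κ * l ^ 2)) ^ a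
  let K : ℕ → ℝ := fun c => (a + 2) * K₀ c
  obtain ⟨C, hCm, hC, hCP⟩ := exists_monotone_tendsto_eventually (P := fun i c =>
    ∀ h ∈ {h : Fin (d + 1) → ℤ | ∀ k, |(h k : ℝ)| ≤ K c}, (∃ x ∈ A, relation h x ≠ 0) →
      (d + 1) * (K c * ((c₃ + cN) * r i)) < δ h) (by
    intro c
    refine (eventually_all_finite (finite_setOf_forall_abs_le (K c))).2 fun h _ => ?_
    by_cases hh : ∃ x ∈ A, relation h x ≠ 0
    · have hlim : Tendsto (fun i => (d + 1) * (K c * ((c₃ + cN) * r i))) atTop (nhds 0) := by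
        simpa using (((hrlim.const_mul (c₃ + cN)).const_mul (K c)).const_mul ((d : ℝ) + 1))
      filter_upwards [hlim.eventually_lt_const (hδpos h hh)] with i hi _ using hi
    · exact Eventually.of_forall fun i hi => absurd hi hh)
  -- Chosen so that `q ^ (1 + 1 / a) > X i` and `q ^ (1 / a) * η < C i` give `cP * η < κ * r i * q`.
  -- The `+ 1` keeps `X` positive when `C i = 0`.
  let X : ℕ → ℝ := fun i => cP * (C i + 1) / (κ * r i)
  have hXpos : ∀ i, 0 < X i := fun i => by
    have := hrpos i
    positivity
  have hXr : ∀ i, X (i + 1) * r i = cP * (C (i + 1) + 1) / (κ * l ^ 2) := fun i => by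
    have := (hrpos i).ne'
    simp only [X, hrs]
    field_simp
  have hrm : ∀ i, r (i + 1) ≤ r i := fun i => by
    rw [hrs]
    exact mul_le_of_le_one_left (hrpos i).le (pow_le_one₀ hl.le hl1.le)
  have hXm : Monotone X := by
    refine monotone_nat_of_le_succ fun i => ?_
    have h1 := hrpos (i + 1)
    have h2 := hrm i
    have h3 : (C i : ℝ) ≤ C (i + 1) := by exact_mod_cast hCm i.le_succ
    simp only [X]
    gcongr
  have hX : Tendsto X atTop atTop := by
    have h1 : Tendsto (fun i => (cP / (κ * ρ)) * (C i : ℝ)) atTop atTop :=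
      (tendsto_natCast_atTop_atTop.comp hC).const_mul_atTop (by positivity)
    refine tendsto_atTop_mono (fun i => ?_) h1
    have h2 := hrpos i
    have h3 := hrρ i
    calc cP / (κ * ρ) * (C i : ℝ) = cP * C i / (κ * ρ) := by ring
      _ ≤ cP * (C i + 1) / (κ * r i) := by
        gcongr
        linarith
  -- the integer vectors relevant at stage `i`
  let S : ℕ → A → Set (Fin (d + 1) → ℤ) := fun i x =>
    {v | 1 ≤ v 0 ∧ (v 0 : ℝ) ^ (1 + 1 / (a : ℝ)) ≤ X (i + 1) ∧
      ‖displacement v x‖ ≤ c₃ * (v 0) * r i}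
  have hE : ∀ i x, ∃ p, IsUnitForm N A p ∧
      (Module.finrank ℝ (Submodule.span ℝ
        ((fun (v : Fin (d + 1) → ℤ) k => (v k : ℝ)) '' S i x)) ≤ a →
      ∀ v ∈ S i x, ∀ ξ ∈ A, |p.1 ξ + p.2.1| * v 0 ≤ N (P (displacement v ξ))) := by
    intro i x
    by_cases hfr : Module.finrank ℝ (Submodule.span ℝ
        ((fun (v : Fin (d + 1) → ℤ) k => (v k : ℝ)) '' S i x)) ≤ a
    · obtain ⟨p, hp, hpS⟩ := exists_isUnitForm_of_finrank_span_le hN hdir x₀ P hP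
        (S := S i x) (fun v hv => one_pos.trans_le hv.1) (by rwa [hA])
      exact ⟨p, hp, fun _ => hpS⟩
    · obtain ⟨p, hp⟩ := exists_isUnitForm_of_direction_ne_bot (A := A) hN hdir
      exact ⟨p, hp, fun h => absurd h hfr⟩
  choose E hEu hES using hE
  -- Even blocks handle the ranges of `q`, and odd blocks run through the integer relations. The
  -- default `0` fills the indices that encode no relation.
  let D : ℕ → A → ((Fin d → ℝ) →ₗ[ℝ] ℝ) × ℝ × A.direction := fun j x =>
    if j % 2 = 0 then E (j / 2) x else G ((Encodable.decode (j / 2)).getD 0)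
  have hDE : ∀ i x, D (2 * i) x = E i x := fun i x => by simp [D]
  have hDG : ∀ h x, D (2 * Encodable.encode h + 1) x = G h := fun h x => by
    have h1 : (2 * Encodable.encode h + 1) % 2 ≠ 0 := by omega
    have h2 : (2 * Encodable.encode h + 1) / 2 = Encodable.encode h := by omega
    simp only [D, if_neg h1, h2, Encodable.encodek, Option.getD_some]
  refine ⟨D, fun j x => ?_, fun ξ x hx0 hξ hD => ?_⟩
  · simp only [D]
    split_ifs
    · exact hEu _ _
    · exact hG _
  have hξ' : ∀ i, ‖(ξ : Fin d → ℝ) - x (2 * i)‖ ≤ cN * r i := fun i =>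
    (hNn _).trans (mul_le_mul_of_nonneg_left (hξ (2 * i)) hcN.le)
  have hxY : ∀ i, ‖(x (2 * i) : Fin d → ℝ)‖ ≤ Y := by
    intro i
    have h1 := hξ' i
    have h2 := hξ' 0
    rw [mul_zero, hx0] at h2
    have h3 := mul_le_mul_of_nonneg_left (hrρ i) hcN.le
    have h4 := mul_le_mul_of_nonneg_left (hrρ 0) hcN.le
    have h5 : (x (2 * i) : Fin d → ℝ) = x₀ + (ξ - x₀) - (ξ - x (2 * i)) := by abel
    have h6 := norm_sub_le ((x₀ : Fin d → ℝ) + (ξ - x₀)) (ξ - x (2 * i))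
    have h7 := norm_add_le (x₀ : Fin d → ℝ) (ξ - x₀)
    rw [← h5] at h6
    simp only [Y]
    linarith
  have hrel : ∀ h, (∃ x ∈ A, relation h x ≠ 0) → δ h ≤ |relation h ξ| := by
    intro h hh
    refine hδ h hh ξ ξ.2 ?_
    have := hD (2 * Encodable.encode h + 1)
    rwa [hDG] at this
  have hfr : ∀ᶠ i in atTop, Module.finrank ℝ (Submodule.span ℝ
      ((fun (v : Fin (d + 1) → ℤ) k => (v k : ℝ)) '' S i (x (2 * i)))) ≤ a := by
    filter_upwards [hCP] with i hi
    by_contra hgt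
    obtain ⟨v, hvS, hvli⟩ := exists_linearIndependent_of_lt_finrank_span (not_le.1 hgt)
    have hminor := fun g => abs_minor_le ha hc₃.le (hrpos i).le (hrρ i) hY (hxY i)
      (fun k => (hvS k).1) (fun k => (hvS k).2.1) (fun k => (hvS k).2.2) g
    simp only [hXr] at hminor
    obtain ⟨h, hhK, hhv, hhA⟩ := exists_integer_relation hA x₀ hΓ hvli hminor
    have hv1 : 0 < v 0 0 := one_pos.trans_le (hvS 0).1
    have hvR : (0 : ℝ) < v 0 0 := by exact_mod_cast hv1
    have hdisp : ‖displacement (v 0) ξ‖ ≤ (v 0 0 : ℝ) * ((c₃ + cN) * r i) := by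
      have h1 := norm_displacement_le (v 0) hv1.le (x (2 * i)) ξ
      have h2 := (hvS 0).2.2
      have h3 := mul_le_mul_of_nonneg_left (hξ' i) hvR.le
      rw [norm_sub_rev] at h1
      linarith
    have hle := abs_relation_le hhK hv1 (hhv 0) (by have := hrpos i; positivity) hdisp
    exact absurd ((hrel h hhA).trans hle) (not_le.2 (hi h hhK hhA))
  refine mem_omegaStar_of_ranges hXm hX hC ?_
  filter_upwards [hfr] with i hi q hq1 hq2
  have ha' : (0 : ℝ) < a := by exact_mod_cast ha
  have hq0 : 0 < q := by
    rcases Nat.eq_zero_or_pos q with rfl | h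
    · rw [Nat.cast_zero, Real.zero_rpow (by positivity)] at hq1
      exact absurd hq1 (not_lt.2 (hXpos i).le)
    · exact h
  have hqR : (0 : ℝ) < q := by exact_mod_cast hq0
  by_contra hlt
  set η := ⨆ k : Fin d, distInt ((q : ℝ) * (ξ : Fin d → ℝ) k) with hη
  set v : Fin (d + 1) → ℤ := Fin.cons (q : ℤ) fun k => round ((q : ℝ) * (ξ : Fin d → ℝ) k)
  have hvη : ‖displacement v ξ‖ ≤ η := le_iSup_distInt
  have hv0 : v 0 = (q : ℤ) := rfl
  have hv0R : (v 0 : ℝ) = q := by rw [hv0]; simp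
  have hq' : 0 < (q : ℝ) ^ ((1 : ℝ) / a) := Real.rpow_pos_of_pos hqR _
  have hηq : cP * η < κ * r i * q := by
    have hri := hrpos i
    have h1 : (q : ℝ) ^ ((1 : ℝ) / a) * η < C i + 1 := (not_le.1 hlt).trans (lt_add_one _)
    simp only [X] at hq1
    rw [Real.rpow_add hqR, Real.rpow_one, div_lt_iff₀ (by positivity)] at hq1
    have h2 : (q : ℝ) ^ ((1 : ℝ) / a) * (cP * η) < (q : ℝ) ^ ((1 : ℝ) / a) * (κ * r i * q) := by
      have := mul_lt_mul_of_pos_left h1 hcP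
      linarith
    exact lt_of_mul_lt_mul_left h2 hq'.le
  have hvS : v ∈ S i (x (2 * i)) := by
    refine ⟨by rw [hv0]; exact_mod_cast hq0, by rw [hv0R]; exact hq2, ?_⟩
    have h1 := norm_displacement_le v (by rw [hv0]; positivity) ξ (x (2 * i))
    have h2 : η ≤ κ / cP * (q * r i) := by
      rw [div_mul_eq_mul_div, le_div_iff₀ hcP]
      linarith
    have h3 := mul_le_mul_of_nonneg_left (hξ' i) hqR.le
    rw [hv0R] at h1 ⊢
    simp only [c₃]
    linarith
  -- Avoiding the hyperplane of block `2i` now forces `κ * r i * q ≤ cP * η`, against `hηq`.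
  have h1 := hES i (x (2 * i)) hi v hvS ξ ξ.2
  have h2 := hD (2 * i)
  rw [hDE] at h2
  rw [hv0R] at h1
  have h3 := mul_le_mul_of_nonneg_right h2 hqR.le
  have h4 := (hPn (displacement v ξ)).trans (mul_le_mul_of_nonneg_left hvη hcP.le)
  have h5 : κ * r i * q ≤ cP * η := h3.trans (h1.trans h4)
  linarith

theorem isWinning_omegaStar (hN : ∀ x, N x = 0 → x = 0) {a : ℕ} (ha : 0 < a)
    (hA : Module.finrank ℝ A.direction = a) (hΓ : latticeDim A ≤ a) {α β : ℝ} (hα : 0 < α)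
    (hα1 : α < 1) (hβ : 0 < β) (hβ1 : β < 1) (hαβ : 0 < 1 + α * β - 2 * α) :
    SchmidtGame.IsWinning (ball A N) α β (omegaStar A a) := by
  obtain ⟨t, κ, ht, hκ, h⟩ :=
    exists_isWinning_of_avoids_hyperplanes (A := A) hN hα hα1 hβ hβ1 hαβ
  refine h _ fun ρ hρ x₀ => ?_
  obtain ⟨D, hDu, hD⟩ := exists_hyperplanes_omegaStar (N := N) hN ha hA hΓ
    (pow_pos (mul_pos hα hβ) t) (pow_lt_one₀ (mul_pos hα hβ).le (by nlinarith) ht.ne') hκ hρ x₀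
  exact ⟨fun j x => (D j x).1, fun j x => (D j x).2.1, fun j x => (D j x).2.2, hDu, hD⟩

end AffineApprox

theorem theorem4 (d a : ℕ) (A : AffineSubspace ℝ (Fin d → ℝ))
    (hA : Module.finrank ℝ A.direction = a)
    (hΓ : AffineApprox.latticeDim A < a)
    (N : Seminorm ℝ (Fin d → ℝ)) (hN : ∀ x, N x = 0 → x = 0) :
    (∀ α β : ℝ, 0 < α → α < 1 → 0 < β → β < 1 → 0 < 1 + α * β - 2 * α →
      SchmidtGame.IsWinning (AffineApprox.ball A N) α β (AffineApprox.omegaStar A a)) ∧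
    (∀ α : ℝ, 0 < α → α ≤ 1 / 2 →
      SchmidtGame.IsAlphaWinning (AffineApprox.ball A N) α (AffineApprox.omegaStar A a)) := by
  have ha : 0 < a := (Nat.zero_le _).trans_lt hΓ
  have key : ∀ α β : ℝ, 0 < α → α < 1 → 0 < β → β < 1 → 0 < 1 + α * β - 2 * α →
      SchmidtGame.IsWinning (AffineApprox.ball A N) α β (AffineApprox.omegaStar A a) :=
    fun α β hα hα1 hβ hβ1 hαβ =>
      AffineApprox.isWinning_omegaStar hN ha hA hΓ.le hα hα1 hβ hβ1 hαβ
  refine ⟨key, fun α hα hα2 β hβ hβ1 => key α β hα (by linarith) hβ hβ1 ?_⟩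
  have := mul_pos hα hβ
  linarith
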